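/- Theorem 5.1. Put $t(n)=3$ for $n\le 4$ and $t(n)=2$ for $n\ge 5$. Let $\mathbb F_q$ be a finite field of characteristic $p$, let $T$ be a finite proper extension field of $\mathbb F_q$, and let $V$ be a finite-dimensional $T$-vector space, of dimension $l$. For a group $X$ of permutations of $V$ let $b(X)$ be the minimal size of a base of $X$, that is, of a subset of $V$ whose pointwise stabilizer in $X$ is trivial. Let $G\le \Gamma L(l,T)$ be a group of $T$-semilinear bijections of $V$, and let $H=G\cap GL(l,T)$ be the subgroup of its $T$-linear elements. Suppose that $G$ is $p$-solvable (it has a normal series each factor of which is a $p$-group or has order prime to $p$). If $b(H)\le t(|T|)$, then $b(G)\le t(|T|)$. -/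

import Mathlib

/-- The function `t`: `t(q) = 3` for `q ≤ 4` and `t(q) = 2` for `q ≥ 5`. -/
def baseBound (q : ℕ) : ℕ := if q ≤ 4 then 3 else 2

/-- The minimal base size `b(G)` of a group `G` acting on `X`: the least cardinality of a finite
set `s` of points whose pointwise stabilizer in `G` is trivial. (For a faithful action on a finite
set such an `s` exists.) -/
noncomputable def minBaseSize (G X : Type*) [Group G] [MulAction G X] : ℕ :=
  sInf {n : ℕ | ∃ s : Finset X, s.card = n ∧ fixingSubgroup G (s : Set X) = ⊥}

/-- A finite group `G` is `p`-solvable: it has a series of normal subgroups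
`1 = N 0 ≤ N 1 ≤ ... ≤ N n = G` each of whose factors `N (i + 1) / N i` is a `p`-group or has order
prime to `p`. (The order of the factor is `(N i).relIndex (N (i + 1))`.) -/
def IsPSolvable (p : ℕ) (G : Type*) [Group G] : Prop :=
  ∃ (n : ℕ) (N : ℕ → Subgroup G), N 0 = ⊥ ∧ N n = ⊤ ∧ (∀ i ≤ n, (N i).Normal) ∧
    ∀ i < n, N i ≤ N (i + 1) ∧
      ((∃ k : ℕ, (N i).relIndex (N (i + 1)) = p ^ k) ∨ ¬ p ∣ (N i).relIndex (N (i + 1)))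

section Semilinear

variable (T V : Type*) [Field T] [AddCommGroup V] [Module T V]

/-- The group `ΓL(V)` of all `T`-semilinear bijections of the `T`-vector space `V`, as a group of
permutations of `V`: the additive bijections `g` such that `g (c • v) = σ c • g v` for some field
automorphism `σ` of `T`. -/
def semilinearGroup : Subgroup (Equiv.Perm V) where
  carrier := {g | (∀ v w : V, g (v + w) = g v + g w) ∧
    ∃ σ : T ≃+* T, ∀ (c : T) (v : V), g (c • v) = σ c • g v}
  one_mem' := ⟨fun _ _ => rfl, RingEquiv.refl T, fun _ _ => rfl⟩
  mul_mem' := by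
    rintro g h ⟨hg, σ, hσ⟩ ⟨hh, τ, hτ⟩
    refine ⟨fun v w => ?_, τ.trans σ, fun c v => ?_⟩
    · simp [Equiv.Perm.mul_apply, hg, hh]
    · simp [Equiv.Perm.mul_apply, hσ, hτ]
  inv_mem' := by
    rintro g ⟨hg, σ, hσ⟩
    refine ⟨fun v w => ?_, σ.symm, fun c v => ?_⟩
    · apply g.injective
      rw [hg]
      simp
    · apply g.injective
      rw [hσ]
      simp

/-- The group `GL(V)` of all `T`-linear bijections of the `T`-vector space `V`, as a group of
permutations of `V`. -/
def linearGroup : Subgroup (Equiv.Perm V) where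
  carrier := {g | (∀ v w : V, g (v + w) = g v + g w) ∧
    ∀ (c : T) (v : V), g (c • v) = c • g v}
  one_mem' := ⟨fun _ _ => rfl, fun _ _ => rfl⟩
  mul_mem' := by
    rintro g h ⟨hg, hg'⟩ ⟨hh, hh'⟩
    refine ⟨fun v w => ?_, fun c v => ?_⟩
    · simp [Equiv.Perm.mul_apply, hg, hh]
    · simp [Equiv.Perm.mul_apply, hg', hh']
  inv_mem' := by
    rintro g ⟨hg, hg'⟩
    refine ⟨fun v w => ?_, fun c v => ?_⟩
    · apply g.injective
      rw [hg]
      simp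
    · apply g.injective
      rw [hg']
      simp

end Semilinear

/-! The values of `baseBound` enter only through being of the form `k + 2`. Let `S` be a base of `H`
with at most `k + 2` points and let `W` be its span. Only `W` matters: a linear element of `G` that
fixes `W` pointwise is trivial. If `dim W < k + 2`, there is room for one more vector `μ • v`, where
`μ` generates the unit group of `T`. Fixing both `v ≠ 0` and `μ • v` makes a semilinear map linear.

If `dim W = k + 2`, keep `k` basis vectors and replace the other two inside the plane they span.
This needs a basis of the plane fixed only by linear elements of the subgroup `A` that preserves the
plane and fixes the `k` vectors (`IsPSolvable.exists_pair_of_semilinear`).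

Suppose every basis of the plane is fixed by a nonlinear element. A Hilbert 90 averaging argument
produces a nontrivial linear transvection for every basis, and conjugating it by a nonlinear element
gives a second one, independent over the prime field. The linear part of `A` is `p`-solvable, so
some normal subgroup has a nontrivial image modulo scalars that is a `p`-group or of order prime to
`p`. A `p`-group fixes a point of the projective line, and the transvections move it to two further
fixed points, so it is scalar. A `p'`-group is acted on without fixed points by a group of
transvections of order `p ^ 2`, which a character-sum argument on endomorphisms rules out
(`not_isPSolvable_of_transvections`). -/

/-! ### Subgroups and images of `p`-solvable groups -/

theorem IsPSolvable.of_injective {p : ℕ} (hp : p.Prime) {G A : Type*} [Group G] [Group A]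
    (h : IsPSolvable p G) (f : A →* G) (hf : Function.Injective f) : IsPSolvable p A := by
  obtain ⟨n, N, h0, hn, hN, hi⟩ := h
  refine ⟨n, fun i => (N i).comap f, ?_, ?_, fun i hin => ?_, fun i hin => ?_⟩
  · simp only [h0]
    exact (MonoidHom.ker_eq_bot_iff f).2 hf
  · simp only [hn, Subgroup.comap_top]
  · have := hN i hin
    infer_instance
  · obtain ⟨hle, hd⟩ := hi i hin
    refine ⟨Subgroup.comap_mono hle, ?_⟩
    have hnorm := hN i hin.le
    have hdvd : ((N i).comap f).relIndex ((N (i + 1)).comap f) ∣ (N i).relIndex (N (i + 1)) := by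
      rw [Subgroup.relIndex_comap]
      have hsub : Subgroup.map f ((N (i + 1)).comap f) ≤ N (i + 1) := Subgroup.map_comap_le f _
      have key := Subgroup.relIndex_dvd_index_of_normal ((N i).subgroupOf (N (i + 1)))
        ((Subgroup.map f ((N (i + 1)).comap f)).subgroupOf (N (i + 1)))
      rwa [Subgroup.relIndex_subgroupOf hsub] at key
    rcases hd with ⟨k, hk⟩ | hd
    · rw [hk] at hdvd
      obtain ⟨m, -, hm⟩ := (Nat.dvd_prime_pow hp).1 hdvd
      exact Or.inl ⟨m, hm⟩
    · exact Or.inr fun h' => hd (h'.trans hdvd)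

/-- Take the first term of the series not contained in `φ.ker`: its image is a quotient of a single
factor. -/
theorem IsPSolvable.exists_normal_map_ne_bot {p : ℕ} (hp : p.Prime) {G B : Type*} [Group G]
    [Group B] (h : IsPSolvable p G) (φ : G →* B) (hφ : ∃ g, φ g ≠ 1) :
    ∃ Q : Subgroup G, Q.Normal ∧ (∃ g ∈ Q, φ g ≠ 1) ∧
      ((∃ k, Nat.card (Q.map φ) = p ^ k) ∨ ¬ p ∣ Nat.card (Q.map φ)) := by
  classical
  obtain ⟨n, N, h0, hn, hN, hi⟩ := h
  have hex : ∃ i, i ≤ n ∧ ∃ g ∈ N i, φ g ≠ 1 := by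
    obtain ⟨g, hg⟩ := hφ
    exact ⟨n, le_rfl, g, hn ▸ Subgroup.mem_top g, hg⟩
  obtain ⟨hin, hne⟩ := Nat.find_spec hex
  have hmin := fun j => @Nat.find_min _ _ hex j
  generalize Nat.find hex = i at hin hne hmin
  rcases i with - | i
  · obtain ⟨g, hg, hg'⟩ := hne
    rw [h0, Subgroup.mem_bot] at hg
    exact absurd (by rw [hg, map_one]) hg'
  · have hker : N i ≤ φ.ker := fun g hg => by
      by_contra hg'
      exact hmin i i.lt_succ_self ⟨by omega, g, hg, hg'⟩
    refine ⟨N (i + 1), hN _ hin, hne, ?_⟩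
    have hdvd : Nat.card ((N (i + 1)).map φ) ∣ (N i).relIndex (N (i + 1)) := by
      rw [← Subgroup.relIndex_ker]
      exact Subgroup.relIndex_dvd_of_le_left _ hker
    rcases (hi i hin).2 with ⟨k, hk⟩ | hd
    · rw [hk] at hdvd
      obtain ⟨m, -, hm⟩ := (Nat.dvd_prime_pow hp).1 hdvd
      exact Or.inl ⟨m, hm⟩
    · exact Or.inr fun h' => hd (h'.trans hdvd)

/-! ### Fixed-point-free action and averaging -/

/-- If a family `u` of automorphisms sums to zero, contains the identity, normalizes the finite
group `N` of order invertible on `M`, and all its other members act on `N` by conjugation without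
nontrivial fixed points, then `N` is trivial. -/
theorem eq_one_of_sum_eq_zero_of_fixedPointFree {Γ M ι : Type*} [Group Γ] [AddCommGroup M]
    [DistribMulAction Γ M] [FaithfulSMul Γ M] [Fintype ι] (N : Subgroup Γ) [Finite N]
    (u : ι → Γ) (i₀ : ι) (h₀ : u i₀ = 1) (hsum : ∀ m : M, ∑ i, u i • m = 0)
    (hnorm : ∀ i, ∀ x ∈ N, u i * x * (u i)⁻¹ ∈ N)
    (hfree : ∀ i, i ≠ i₀ → ∀ x ∈ N, u i * x = x * u i → x = 1)
    (hinv : ∀ m : M, Nat.card N • m = 0 → m = 0) {z : Γ} (hz : z ∈ N) : z = 1 := by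
  classical
  have : Fintype N := Fintype.ofFinite N
  have hconj : ∀ i, i ≠ i₀ → ∀ m : M,
      ∑ x : N, ((x : Γ) * u i * (x : Γ)⁻¹) • m = ∑ x : N, (x : Γ) • u i • m := by
    intro i hi m
    -- Here `x * u i * x⁻¹ = f x * u i`, and `f` permutes `N` because `f x = f y` makes `u i`
    -- commute with `y⁻¹ * x`.
    let f : N → N := fun x => x * ⟨u i * ((x⁻¹ : N) : Γ) * (u i)⁻¹, hnorm i _ (x⁻¹ : N).2⟩
    have hf : Function.Injective f := by
      intro x y hxy
      have h1 : (x : Γ) * (u i * (x : Γ)⁻¹ * (u i)⁻¹) = y * (u i * (y : Γ)⁻¹ * (u i)⁻¹) := by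
        simpa [f] using congrArg Subtype.val hxy
      have h2 : (x : Γ) * u i * (x : Γ)⁻¹ = y * u i * (y : Γ)⁻¹ := by
        simpa [← mul_assoc] using h1
      have h3 : (y⁻¹ * x : N) = 1 := by
        apply Subtype.ext
        refine hfree i hi _ (y⁻¹ * x : N).2 ?_
        have h4 : (x : Γ) * u i = y * u i * (y : Γ)⁻¹ * x := by rw [← h2]; group
        rw [Subgroup.coe_mul, Subgroup.coe_inv, mul_assoc, h4]
        group
      exact (inv_mul_eq_one.1 h3).symm
    have hb : Function.Bijective f := Finite.injective_iff_bijective.1 hf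
    rw [← Function.Bijective.sum_comp hb (fun x : N => (x : Γ) • u i • m)]
    refine Finset.sum_congr rfl fun x _ => ?_
    rw [smul_smul]
    simp [f, mul_assoc]
  have hfix : ∀ m : M, Nat.card N • m = ∑ x : N, (x : Γ) • m := by
    intro m
    have h1 : ∑ i, ∑ x : N, ((x : Γ) * u i * (x : Γ)⁻¹) • m = 0 := by
      rw [Finset.sum_comm]
      refine Finset.sum_eq_zero fun x _ => ?_
      have := congrArg (fun m => (x : Γ) • m) (hsum ((x : Γ)⁻¹ • m))
      simpa [Finset.smul_sum, smul_smul, mul_assoc] using this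
    have h2 : ∑ i, ∑ x : N, (x : Γ) • u i • m = 0 := by
      rw [Finset.sum_comm]
      refine Finset.sum_eq_zero fun x _ => ?_
      rw [← Finset.smul_sum, hsum, smul_zero]
    -- The two vanishing double sums agree off `i₀`, so their `i₀` terms `|N| • m` and `∑ x • m`
    -- agree. The latter is `N`-invariant.
    rw [← Finset.add_sum_erase _ _ (Finset.mem_univ i₀)] at h1 h2
    rw [Finset.sum_congr rfl fun i hi => hconj i (Finset.ne_of_mem_erase hi) m] at h1
    have h3 := add_right_cancel (h1.trans h2.symm)
    simpa [h₀] using h3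
  refine FaithfulSMul.eq_of_smul_eq_smul (α := M) fun m => ?_
  rw [one_smul, ← sub_eq_zero]
  apply hinv
  rw [smul_sub, smul_comm, hfix, Finset.smul_sum, sub_eq_zero]
  simp_rw [smul_smul]
  exact Fintype.sum_equiv (Equiv.mulLeft (⟨z, hz⟩ : N)) _ _ fun x => rfl

/-! ### Linear groups of a plane modulo scalars -/

section Plane

variable {T W : Type*} [Field T] [AddCommGroup W] [Module T W]

theorem end_eq_of_eq_on_pair (h2 : Module.finrank T W = 2) {u v : W}
    (huv : LinearIndependent T ![u, v]) {f g : Module.End T W} (hu : f u = g u) (hv : f v = g v) :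
    f = g := by
  refine LinearMap.ext_on (huv.span_eq_top_of_card_eq_finrank (by simp [h2])) ?_
  rintro x ⟨i, rfl⟩
  fin_cases i
  · exact hu
  · exact hv

theorem exists_eq_smul_add_smul (h2 : Module.finrank T W = 2) {u v : W}
    (huv : LinearIndependent T ![u, v]) (x : W) : ∃ a b : T, x = a • u + b • v := by
  have hx : x ∈ Submodule.span T (Set.range ![u, v]) := by
    rw [huv.span_eq_top_of_card_eq_finrank (by simp [h2])]
    trivial
  rw [Matrix.range_cons, Matrix.range_cons, Matrix.range_empty, Set.union_empty,
    Set.singleton_union, Submodule.mem_span_pair] at hx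
  obtain ⟨a, b, h⟩ := hx
  exact ⟨a, b, h.symm⟩

/-- The nilpotent endomorphism of a plane that kills `u` and maps `v` to `u`. -/
theorem exists_nilpotent (h2 : Module.finrank T W = 2) {u v : W}
    (huv : LinearIndependent T ![u, v]) :
    ∃ n : Module.End T W, n u = 0 ∧ n v = u ∧ n * n = 0 := by
  let b := basisOfLinearIndependentOfCardEqFinrank huv (by simp [h2])
  have hb0 : b 0 = u := by simp [b]
  have hb1 : b 1 = v := by simp [b]
  let n : Module.End T W := b.constr T ![0, u]
  have hu : n u = 0 := by
    rw [← hb0]; simp [n]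
  have hv : n v = u := by
    rw [← hb1]; simp [n]
  exact ⟨n, hu, hv, end_eq_of_eq_on_pair h2 huv (by simp [hu]) (by simp [hu, hv])⟩

variable {L : Type*} [Group L]

/-- The conjugation action on endomorphisms induced by a linear representation. -/
noncomputable def conjHom (ρ : L →* (Module.End T W)ˣ) : L →* RingAut (Module.End T W) :=
  (MulSemiringAction.toRingAut (ConjAct (Module.End T W)ˣ) (Module.End T W)).comp
    (ConjAct.toConjAct.toMonoidHom.comp ρ)

theorem conjHom_smul (ρ : L →* (Module.End T W)ˣ) (g : L) (m : Module.End T W) :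
    conjHom ρ g • m = (ρ g : Module.End T W) * m * ((ρ g)⁻¹ : (Module.End T W)ˣ) := rfl

/-- The center of the endomorphism algebra consists of scalars. So the image of `conjHom` is the
projective image of `L`, acting faithfully on an additive group. -/
theorem conjHom_eq_one_iff (ρ : L →* (Module.End T W)ˣ) (g : L) :
    conjHom ρ g = 1 ↔ ∃ a : T, (ρ g : Module.End T W) = a • 1 := by
  constructor
  · intro h
    have hc : (ρ g : Module.End T W) ∈ Subalgebra.center T (Module.End T W) := by
      rw [Subalgebra.mem_center_iff]
      intro m
      have h1 : conjHom ρ g • m = m := by rw [h, one_smul]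
      rw [conjHom_smul, Units.mul_inv_eq_iff_eq_mul] at h1
      exact h1.symm
    rw [Algebra.IsCentral.center_eq_bot, Algebra.mem_bot] at hc
    obtain ⟨a, ha⟩ := hc
    exact ⟨a, by rw [← ha, Algebra.algebraMap_eq_smul_one]⟩
  · rintro ⟨a, ha⟩
    refine FaithfulSMul.eq_of_smul_eq_smul (α := Module.End T W) fun m => ?_
    rw [conjHom_smul, one_smul, Units.mul_inv_eq_iff_eq_mul, ha]
    simp

theorem eq_smul_one_of_three_eigenvectors (h2 : Module.finrank T W = 2) {u v : W}
    (huv : LinearIndependent T ![u, v]) {X : Module.End T W} {c₀ c₁ α β γ : T} (h₀ : c₀ ≠ 0)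
    (h₁ : c₁ ≠ 0) (hne : c₀ ≠ c₁) (hα : X u = α • u) (hβ : X (u + c₀ • v) = β • (u + c₀ • v))
    (hγ : X (u + c₁ • v) = γ • (u + c₁ • v)) : X = α • 1 := by
  rw [LinearMap.map_add, LinearMap.map_smul, hα] at hβ hγ
  obtain ⟨a, b, hab⟩ := exists_eq_smul_add_smul h2 huv (X v)
  rw [hab] at hβ hγ
  have e : ∀ {c δ : T}, α • u + c • (a • u + b • v) = δ • (u + c • v) →
      α + c * a = δ ∧ c * b = δ * c := by
    intro c δ h
    have := (LinearIndependent.pair_iff.1 huv) (α + c * a - δ) (c * b - δ * c) (by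
      rw [← sub_eq_zero] at h
      rw [← h]
      module)
    exact ⟨sub_eq_zero.1 this.1, sub_eq_zero.1 this.2⟩
  obtain ⟨e1, e2⟩ := e hβ
  obtain ⟨e3, e4⟩ := e hγ
  have hbβ : b = β := mul_left_cancel₀ h₀ (by rw [e2, mul_comm])
  have ha : a = 0 := by
    have hbγ : b = γ := mul_left_cancel₀ h₁ (by rw [e4, mul_comm])
    have : (c₀ - c₁) * a = 0 := by linear_combination e1 - e3 - hbβ + hbγ
    exact (mul_eq_zero.1 this).resolve_left (sub_ne_zero.2 hne)
  refine end_eq_of_eq_on_pair h2 huv (by simp [hα]) ?_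
  rw [hab, ha]
  have : b = α := by rw [hbβ, ← e1, ha]; ring
  simp [this]

/-- The projective line has `|T| + 1` points, a number prime to `p`, so `Q` fixes some `⟨v⟩`. By
normality it also fixes the translates `⟨v + c₀ • u⟩` and `⟨v + c₁ • u⟩`, and three eigenlines force
a scalar. -/
theorem conjHom_eq_one_of_isPGroup [Finite T] {p : ℕ} [Fact p.Prime] [CharP T p]
    (h2 : Module.finrank T W = 2) (ρ : L →* (Module.End T W)ˣ)
    (htr : ∀ u v : W, LinearIndependent T ![u, v] → ∃ c₀ c₁ : T, c₀ ≠ 0 ∧ c₁ ≠ 0 ∧ c₀ ≠ c₁ ∧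
      ∀ c, c = c₀ ∨ c = c₁ → ∃ g : L, (ρ g : Module.End T W) v = v + c • u)
    (Q : Subgroup L) [Q.Normal] (hQ : ∀ x ∈ Q, ∃ k : ℕ, conjHom ρ x ^ p ^ k = 1) {x : L}
    (hx : x ∈ Q) : conjHom ρ x = 1 := by
  let ψ : L →* Equiv.Perm (Projectivization T W) :=
    (MulAction.toPermHom (LinearMap.GeneralLinearGroup T W) (Projectivization T W)).comp ρ
  have hψ : ∀ g (w : W) (hw : w ≠ 0), ∃ hw', ψ g (Projectivization.mk T w hw) =
      Projectivization.mk T ((ρ g : Module.End T W) w) hw' := fun g w hw =>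
    ⟨_, Projectivization.smul_mk (G := LinearMap.GeneralLinearGroup T W) (ρ g) hw⟩
  have hker : ∀ g, conjHom ρ g = 1 → ψ g = 1 := by
    intro g hg
    obtain ⟨a, ha⟩ := (conjHom_eq_one_iff ρ g).1 hg
    ext z
    induction z using Projectivization.ind with
    | h w hw =>
      obtain ⟨hw', h⟩ := hψ g w hw
      rw [h, Equiv.Perm.one_apply, Projectivization.mk_eq_mk_iff']
      exact ⟨a, by simp [ha]⟩
  have hP : IsPGroup p (Q.map ψ) := by
    rintro ⟨_, y, hy, rfl⟩
    obtain ⟨k, hk⟩ := hQ y hy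
    refine ⟨k, Subtype.ext ?_⟩
    have := hker (y ^ p ^ k) (by rw [map_pow, hk])
    simpa using this
  have hcard : ¬ p ∣ Nat.card (Projectivization T W) := by
    rw [Projectivization.card_of_finrank_two T W h2, Nat.dvd_add_right]
    · exact (Fact.out : p.Prime).not_dvd_one
    · have := Fintype.ofFinite T
      rw [← CharP.cast_eq_zero_iff T p, Nat.card_eq_fintype_card]
      exact FiniteField.cast_card_eq_zero T
  obtain ⟨z, hz⟩ := hP.nonempty_fixed_point_of_prime_not_dvd_card _ hcard
  have hz' : ∀ y ∈ Q, ψ y z = z := fun y hy => hz ⟨ψ y, y, hy, rfl⟩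
  induction z using Projectivization.ind with
  | h v hv =>
  have hev : ∀ y ∈ Q, ∃ a : T, (ρ y : Module.End T W) v = a • v := by
    intro y hy
    obtain ⟨hw', h⟩ := hψ y v hv
    have := hz' y hy
    rw [h, Projectivization.mk_eq_mk_iff'] at this
    obtain ⟨a, ha⟩ := this
    exact ⟨a, ha.symm⟩
  have hev' : ∀ g : L, ∀ y ∈ Q, ∃ a : T, (ρ y : Module.End T W) ((ρ g : Module.End T W) v) =
      a • (ρ g : Module.End T W) v := by
    intro g y hy
    obtain ⟨a, ha⟩ := hev (g⁻¹ * y * g) (by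
      simpa using Subgroup.Normal.conj_mem ‹Q.Normal› y hy g⁻¹)
    refine ⟨a, ?_⟩
    have hyg : y * g = g * (g⁻¹ * y * g) := by group
    rw [← map_smul, ← ha, ← Module.End.mul_apply, ← Module.End.mul_apply, ← Units.val_mul,
      ← Units.val_mul, ← map_mul, ← map_mul, ← hyg]
  have : FiniteDimensional T W := Module.finite_of_finrank_pos (by omega)
  obtain ⟨u, hu⟩ : ∃ u, LinearIndependent T ![v, u] :=
    exists_linearIndependent_pair_of_one_lt_finrank (by omega) hv
  have huv : LinearIndependent T ![u, v] := LinearIndependent.pair_symm_iff.1 hu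
  obtain ⟨c₀, c₁, h₀, h₁, hne, hg⟩ := htr u v huv
  obtain ⟨g₀, hg₀⟩ := hg c₀ (Or.inl rfl)
  obtain ⟨g₁, hg₁⟩ := hg c₁ (Or.inr rfl)
  obtain ⟨α, hα⟩ := hev x hx
  obtain ⟨β, hβ⟩ := hev' g₀ x hx
  obtain ⟨γ, hγ⟩ := hev' g₁ x hx
  rw [hg₀] at hβ
  rw [hg₁] at hγ
  exact (conjHom_eq_one_iff ρ x).2 ⟨α, eq_smul_one_of_three_eigenvectors h2 hu h₀ h₁ hne hα hβ hγ⟩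

/-- An element commuting with a transvection modulo scalars is trivial modulo scalars if its order
modulo scalars is prime to the characteristic. -/
theorem conjHom_eq_one_of_commute_transvection {p : ℕ} [Fact p.Prime] [CharP T p]
    (h2 : Module.finrank T W = 2) (ρ : L →* (Module.End T W)ˣ) {u v : W}
    (huv : LinearIndependent T ![u, v]) {n : Module.End T W} (hnu : n u = 0) (hnv : n v = u)
    {c : T} (hc : c ≠ 0) {g x : L} (hg : (ρ g : Module.End T W) = 1 + c • n)
    (hcomm : conjHom ρ g * conjHom ρ x = conjHom ρ x * conjHom ρ g)
    (hp : (conjHom ρ x) ^ p = 1 → conjHom ρ x = 1) : conjHom ρ x = 1 := by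
  have hu0 : u ≠ 0 := huv.ne_zero 0
  have h1 : conjHom ρ (x * g * x⁻¹ * g⁻¹) = 1 := by
    rw [map_mul, map_mul, map_mul, ← hcomm, map_inv, map_inv]
    group
  obtain ⟨μ, hμ⟩ := (conjHom_eq_one_iff ρ _).1 h1
  have hXG : (ρ x : Module.End T W) * (1 + c • n) = μ • ((1 + c • n) * ρ x) := by
    have h3 : x * g = (x * g * x⁻¹ * g⁻¹) * (g * x) := by group
    rw [← hg, ← Units.val_mul, ← Units.val_mul, ← map_mul, ← map_mul, h3, map_mul, Units.val_mul,
      hμ, smul_mul_assoc, one_mul]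
  set X : Module.End T W := (ρ x : Module.End T W) with hX
  have hXinj : Function.Injective X := by
    intro a b hab
    have := congrArg ((((ρ x)⁻¹ : (Module.End T W)ˣ) : Module.End T W)) hab
    rw [← Module.End.mul_apply, ← Module.End.mul_apply, hX, Units.inv_mul] at this
    exact this
  obtain ⟨a, b, hab⟩ := exists_eq_smul_add_smul h2 huv (X u)
  obtain ⟨d, e, hde⟩ := exists_eq_smul_add_smul h2 huv (X v)
  have eu := congrArg (fun f => f u) hXG
  have ev := congrArg (fun f => f v) hXG
  simp only [Module.End.mul_apply, LinearMap.add_apply, LinearMap.smul_apply, Module.End.one_apply,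
    hnu, hnv, map_add, map_smul, hab, hde, smul_zero, add_zero] at eu ev
  have key : ∀ r s : T, r • u + s • v = 0 → r = 0 ∧ s = 0 := LinearIndependent.pair_iff.1 huv
  obtain ⟨eu1, eu2⟩ := key (a - μ * (a + c * b)) (b - μ * b) (by
    rw [← sub_eq_zero] at eu
    rw [← eu]
    module)
  obtain ⟨ev1, ev2⟩ := key (d + c * a - μ * (d + c * e)) (e + c * b - μ * e) (by
    rw [← sub_eq_zero] at ev
    rw [← ev]
    module)
  have hb : b = 0 := by
    by_contra hb
    have hμ1 : μ = 1 := by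
      have : (1 - μ) * b = 0 := by linear_combination eu2
      have := (mul_eq_zero.1 this).resolve_right hb
      linear_combination -this
    rw [hμ1] at ev2
    have : c * b = 0 := by linear_combination ev2
    exact hb ((mul_eq_zero.1 this).resolve_left hc)
  have ha : a ≠ 0 := by
    rintro rfl
    rw [hb, zero_smul, zero_smul, add_zero] at hab
    exact hu0 (hXinj (by rw [hab, map_zero]))
  have hμ1 : μ = 1 := by
    have : (1 - μ) * a = 0 := by rw [hb] at eu1; linear_combination eu1
    have := (mul_eq_zero.1 this).resolve_right ha
    linear_combination -this
  have hea : e = a := by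
    have : c * (a - e) = 0 := by rw [hμ1] at ev1; linear_combination ev1
    have := (mul_eq_zero.1 this).resolve_left hc
    linear_combination -this
  -- A scalar plus a nilpotent of square zero: its `p`-th power is the scalar `a ^ p`.
  have hXn : X = a • 1 + d • n := by
    refine end_eq_of_eq_on_pair h2 huv ?_ ?_
    · simp [hab, hb, hnu]
    · simp [hde, hea, hnv, add_comm]
  have hnn : n * n = 0 := end_eq_of_eq_on_pair h2 huv (by simp [hnu]) (by simp [hnu, hnv])
  have : Nontrivial W := ⟨u, 0, hu0⟩
  have : CharP (Module.End T W) p := charP_of_injective_algebraMap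
    (algebraMap T (Module.End T W)).injective p
  have hnp : n ^ p = 0 := by
    obtain ⟨k, hk⟩ := Nat.exists_eq_add_of_le (Fact.out : p.Prime).two_le
    rw [hk, pow_add, pow_two, hnn, zero_mul]
  apply hp
  rw [← map_pow]
  refine (conjHom_eq_one_iff ρ _).2 ⟨a ^ p, ?_⟩
  rw [map_pow, Units.val_pow_eq_pow_val, ← hX, hXn, add_pow_char_of_commute p, smul_pow, smul_pow,
    hnp, one_pow, smul_zero, add_zero]
  exact ((Commute.one_left n).smul_left a).smul_right d

/-- Pure terms are repeated `p` times, and the cross term contains `2 * ∑ i`, zero by `i ↦ -i`. A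
single parameter would fail for the squares when `p` is 2 or 3. -/
theorem sum_zmod_pair_eq_zero {p : ℕ} [Fact p.Prime] [Algebra (ZMod p) T] (c₀ c₁ : T) :
    ∑ i : ZMod p × ZMod p, (i.1 • c₀ + i.2 • c₁) = 0 ∧
      ∑ i : ZMod p × ZMod p, (i.1 • c₀ + i.2 • c₁) ^ 2 = 0 := by
  have hp0 : (p : T) = 0 := by
    rw [← map_natCast (algebraMap (ZMod p) T), CharP.cast_eq_zero, map_zero]
  set f := algebraMap (ZMod p) T
  have hs : (2 : T) * ∑ i : ZMod p, f i = 0 := by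
    have h := Equiv.sum_comp (Equiv.neg (ZMod p)) (fun i => f i)
    simp only [Equiv.neg_apply, map_neg, Finset.sum_neg_distrib] at h
    linear_combination -h
  constructor
  · simp [Fintype.sum_prod_type, Finset.sum_add_distrib, hp0,
      Algebra.smul_def]
  · have : ∀ i : ZMod p × ZMod p, (i.1 • c₀ + i.2 • c₁) ^ 2 =
        f i.1 ^ 2 * c₀ ^ 2 + (f i.1 * f i.2) * (2 * c₀ * c₁) + f i.2 ^ 2 * c₁ ^ 2 := by
      intro i
      rw [Algebra.smul_def, Algebra.smul_def]
      ring
    simp only [this, Finset.sum_add_distrib, ← Finset.sum_mul, Fintype.sum_prod_type,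
      Finset.sum_const, Finset.card_univ, ZMod.card, nsmul_eq_mul, hp0, zero_mul,
      zero_add, add_zero, ← Finset.mul_sum]
    linear_combination (c₀ * c₁ * ∑ i : ZMod p, f i) * hs

theorem conjHom_eq_one_of_coprime {p : ℕ} [Fact p.Prime] [Algebra (ZMod p) T] [Finite L]
    (h2 : Module.finrank T W = 2) (ρ : L →* (Module.End T W)ˣ) {u v : W}
    (huv : LinearIndependent T ![u, v]) {c₀ c₁ : T} (hc : LinearIndependent (ZMod p) ![c₀, c₁])
    (htr : ∀ i j : ZMod p, ∃ g : L, (ρ g : Module.End T W) u = u ∧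
      (ρ g : Module.End T W) v = v + (i • c₀ + j • c₁) • u)
    (Q : Subgroup L) [Q.Normal] (hQ : ¬ p ∣ Nat.card (Q.map (conjHom ρ))) {x : L}
    (hx : x ∈ Q) : conjHom ρ x = 1 := by
  have : CharP T p := charP_of_injective_algebraMap (algebraMap (ZMod p) T).injective p
  have hprime : p.Prime := Fact.out
  obtain ⟨n, hnu, hnv, hnn⟩ := exists_nilpotent h2 huv
  let c : ZMod p × ZMod p → T := fun i => i.1 • c₀ + i.2 • c₁
  have htr' : ∀ i, ∃ g : L, (ρ g : Module.End T W) = 1 + c i • n := by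
    intro i
    obtain ⟨g, hgu, hgv⟩ := htr i.1 i.2
    exact ⟨g, end_eq_of_eq_on_pair h2 huv (by simp [hgu, hnu]) (by simp [hgv, hnv, c])⟩
  choose g hg using htr'
  have hginv : ∀ i, (((ρ (g i))⁻¹ : (Module.End T W)ˣ) : Module.End T W) = 1 - c i • n := by
    intro i
    refine Units.inv_eq_of_mul_eq_one_right ?_
    rw [hg, mul_sub, mul_one, add_mul, one_mul, smul_mul_smul_comm, hnn]
    simp
  have hpow : ∀ y ∈ Q, conjHom ρ y ^ p = 1 → conjHom ρ y = 1 := by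
    intro y hy h
    have ho : orderOf (conjHom ρ y) ∣ Nat.card (Q.map (conjHom ρ)) :=
      Subgroup.orderOf_dvd_natCard _ ⟨y, hy, rfl⟩
    rcases (Nat.dvd_prime hprime).1 (orderOf_dvd_of_pow_eq_one h) with h1 | h1
    · exact orderOf_eq_one_iff.1 h1
    · exact absurd (h1 ▸ ho) hQ
  have : Finite (Q.map (conjHom ρ)) := ((Q : Set L).toFinite.image (conjHom ρ)).to_subtype
  refine eq_one_of_sum_eq_zero_of_fixedPointFree (M := Module.End T W) (Q.map (conjHom ρ))
    (fun i => conjHom ρ (g i)) (0 : ZMod p × ZMod p) ?_ ?_ ?_ ?_ ?_ ⟨x, hx, rfl⟩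
  · exact (conjHom_eq_one_iff ρ _).2 ⟨1, by simp [hg, c]⟩
  · intro m
    obtain ⟨s1, s2⟩ := sum_zmod_pair_eq_zero (p := p) c₀ c₁
    -- Conjugation by `1 + c i • n` is quadratic in `c i`, so only the sums of `1`, `c i` and `c i ^
    -- 2` have to vanish.
    have e : ∀ i, conjHom ρ (g i) • m = m + c i • (n * m - m * n) - c i ^ 2 • (n * m * n) := by
      intro i
      rw [conjHom_smul, hginv, hg]
      simp only [add_mul, mul_sub, one_mul, mul_one, smul_mul_assoc, mul_smul_comm]
      module
    simp only [e, Finset.sum_sub_distrib, Finset.sum_add_distrib, ← Finset.sum_smul]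
    change _ + (∑ i : ZMod p × ZMod p, (i.1 • c₀ + i.2 • c₁)) • _ -
      (∑ i : ZMod p × ZMod p, (i.1 • c₀ + i.2 • c₁) ^ 2) • _ = _
    rw [s1, s2, Finset.sum_const, ← Nat.cast_smul_eq_nsmul T]
    simp
  · rintro i _ ⟨y, hy, rfl⟩
    exact ⟨g i * y * (g i)⁻¹, Subgroup.Normal.conj_mem ‹_› y hy _, by simp⟩
  · rintro i hi _ ⟨y, hy, rfl⟩ hcomm
    have hci : c i ≠ 0 := by
      intro h0
      obtain ⟨e1, e2⟩ := LinearIndependent.pair_iff.1 hc _ _ h0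
      exact hi (Prod.ext e1 e2)
    exact conjHom_eq_one_of_commute_transvection h2 ρ huv hnu hnv hci (hg i) hcomm (hpow y hy)
  · intro m hm
    rw [← Nat.cast_smul_eq_nsmul T] at hm
    refine (smul_eq_zero.1 hm).resolve_left fun h => hQ ((CharP.cast_eq_zero_iff T p _).1 h)

theorem not_isPSolvable_of_transvections [Finite T] {p : ℕ} [Fact p.Prime] [Algebra (ZMod p) T]
    [Finite L] (h2 : Module.finrank T W = 2) (ρ : L →* (Module.End T W)ˣ)
    (htr : ∀ u v : W, LinearIndependent T ![u, v] → ∃ c₀ c₁ : T,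
      LinearIndependent (ZMod p) ![c₀, c₁] ∧ ∀ i j : ZMod p, ∃ g : L,
        (ρ g : Module.End T W) u = u ∧ (ρ g : Module.End T W) v = v + (i • c₀ + j • c₁) • u) :
    ¬ IsPSolvable p L := by
  intro hL
  have hprime : p.Prime := Fact.out
  have : CharP T p := charP_of_injective_algebraMap (algebraMap (ZMod p) T).injective p
  have : FiniteDimensional T W := Module.finite_of_finrank_pos (by omega)
  have : Nontrivial W := Module.nontrivial_of_finrank_pos (R := T) (by omega)
  obtain ⟨u, hu⟩ := exists_ne (0 : W)
  obtain ⟨v, huv⟩ := exists_linearIndependent_pair_of_one_lt_finrank (R := T) (by omega) hu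
  have hne : ∃ g, conjHom ρ g ≠ 1 := by
    obtain ⟨c₀, c₁, hc, h⟩ := htr u v huv
    obtain ⟨g, hgu, hgv⟩ := h 1 0
    refine ⟨g, fun h1 => ?_⟩
    obtain ⟨a, ha⟩ := (conjHom_eq_one_iff ρ g).1 h1
    rw [ha] at hgv
    have := (LinearIndependent.pair_iff.1 huv) (-c₀) (a - 1) (by
      rw [← sub_eq_zero] at hgv
      rw [← hgv]
      simp
      module)
    exact hc.ne_zero 0 (by simpa using this.1)
  obtain ⟨Q, hQn, ⟨x, hx, hx1⟩, hk | hQ⟩ := hL.exists_normal_map_ne_bot hprime (conjHom ρ) hne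
  · obtain ⟨k, hk⟩ := hk
    refine hx1 (conjHom_eq_one_of_isPGroup (p := p) h2 ρ ?_ Q ?_ hx)
    · intro u v huv
      obtain ⟨c₀, c₁, hc, h⟩ := htr u v huv
      refine ⟨c₀, c₁, hc.ne_zero 0, hc.ne_zero 1, fun h01 => ?_, ?_⟩
      · simpa [h01] using (LinearIndependent.pair_iff.1 hc) 1 (-1) (by simp [h01])
      · rintro c (rfl | rfl)
        · obtain ⟨g, -, hg⟩ := h 1 0
          exact ⟨g, by simpa using hg⟩
        · obtain ⟨g, -, hg⟩ := h 0 1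
          exact ⟨g, by simpa using hg⟩
    · intro y hy
      refine ⟨k, ?_⟩
      rw [← hk]
      exact congrArg Subtype.val (pow_card_eq_one' (x := (⟨_, y, hy, rfl⟩ : Q.map (conjHom ρ))))
  · obtain ⟨c₀, c₁, hc, h⟩ := htr u v huv
    exact hx1 (conjHom_eq_one_of_coprime h2 ρ huv hc h Q hQ hx)

end Plane

/-! ### Automorphisms of a finite field and a generator of its units -/

theorem exists_generator_units (T : Type*) [Field T] [Finite T] :
    ∃ μ : T, μ ≠ 0 ∧ ∀ x : T, x ≠ 0 → ∃ n : ℕ, μ ^ n = x := by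
  obtain ⟨g, hg⟩ := IsCyclic.exists_generator (α := Tˣ)
  refine ⟨g, g.ne_zero, fun x hx => ?_⟩
  obtain ⟨n, hn⟩ := mem_powers_iff_mem_zpowers.2 (hg (Units.mk0 x hx))
  exact ⟨n, by simpa using congrArg Units.val hn⟩

/-- Every `x` is sent to a prime-field multiple of itself; comparing `x` with `1 + x` forces the
factor to be 1. -/
theorem ringAut_eq_one_of_map_generator {T : Type*} [Field T] {p : ℕ} [Fact p.Prime]
    [Algebra (ZMod p) T] {μ : T} (hμ : ∀ x : T, x ≠ 0 → ∃ n : ℕ, μ ^ n = x) (σ : RingAut T)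
    {k : ZMod p} (h : σ μ = k • μ) : σ = 1 := by
  have hpow : ∀ x : T, ∃ j : ZMod p, σ x = j • x := by
    intro x
    by_cases hx : x = 0
    · exact ⟨0, by simp [hx]⟩
    · obtain ⟨n, rfl⟩ := hμ x hx
      exact ⟨k ^ n, by rw [map_pow, h, smul_pow]⟩
  ext x
  rw [RingAut.one_apply]
  have hprime : ∀ j : ZMod p, σ (algebraMap (ZMod p) T j) = algebraMap (ZMod p) T j := fun j =>
    RingHom.congr_fun (Subsingleton.elim ((σ : T →+* T).comp (algebraMap (ZMod p) T))
      (algebraMap (ZMod p) T)) j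
  by_cases hli : LinearIndependent (ZMod p) ![1, x]
  · obtain ⟨j, hj⟩ := hpow x
    obtain ⟨i, hi⟩ := hpow (1 + x)
    rw [map_add, map_one, hj] at hi
    obtain ⟨h1, h2⟩ := LinearIndependent.pair_iff.1 hli (1 - i) (j - i) (by
      rw [← sub_eq_zero] at hi
      rw [← hi, smul_add]
      module)
    have : j = 1 := by linear_combination h2 - h1
    rw [hj, this, one_smul]
  · rw [LinearIndependent.pair_iff' one_ne_zero] at hli
    push Not at hli
    obtain ⟨a, rfl⟩ := hli
    rw [← Algebra.algebraMap_eq_smul_one, hprime]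

theorem ringAut_eq_one_of_fix_generator {T : Type*} [Field T] {μ : T}
    (hμ : ∀ x : T, x ≠ 0 → ∃ n : ℕ, μ ^ n = x) (σ : RingAut T) (h : σ μ = μ) : σ = 1 := by
  ext x
  by_cases hx : x = 0
  · simp [hx]
  · obtain ⟨n, rfl⟩ := hμ x hx
    simp [h]

/-! ### Semilinear groups of a plane: producing transvections -/

section SemilinearPlane

variable {A T W : Type*} [Group A] [Field T] [AddCommGroup W] [Module T W] [DistribMulAction A W]

theorem eq_one_of_smul_pair [FaithfulSMul A W] (s : A →* RingAut T)
    (hs : ∀ (g : A) (c : T) (w : W), g • c • w = s g c • g • w) (h2 : Module.finrank T W = 2)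
    {u v : W} (huv : LinearIndependent T ![u, v]) {g : A} (hg : s g = 1) (hu : g • u = u)
    (hv : g • v = v) : g = 1 := by
  refine FaithfulSMul.eq_of_smul_eq_smul (α := W) fun w => ?_
  obtain ⟨a, b, rfl⟩ := exists_eq_smul_add_smul h2 huv w
  rw [smul_add, hs, hs, hg, hu, hv, one_smul]
  rfl

/-- The scalars `c` for which the transvection fixing `u` and mapping `v` to `v + c • u` is induced
by a linear element of `A`. -/
def transvectionScalars (s : A →* RingAut T) (u v : W)
    (hs : ∀ (g : A) (c : T) (w : W), g • c • w = s g c • g • w) : AddSubgroup T where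
  carrier := {c | ∃ g : A, s g = 1 ∧ g • u = u ∧ g • v = v + c • u}
  zero_mem' := ⟨1, map_one s, one_smul _ _, by simp⟩
  add_mem' := by
    rintro c d ⟨g, hg, hgu, hgv⟩ ⟨h, hh, hhu, hhv⟩
    refine ⟨g * h, by rw [map_mul, hg, hh, one_mul], by rw [mul_smul, hhu, hgu], ?_⟩
    rw [mul_smul, hhv, smul_add, hs, hg, hgu, hgv, RingAut.one_apply]
    module
  neg_mem' := by
    rintro c ⟨g, hg, hgu, hgv⟩
    refine ⟨g⁻¹, by rw [map_inv, hg, inv_one], by rw [inv_smul_eq_iff, hgu], ?_⟩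
    rw [inv_smul_eq_iff, smul_add, hs, hg, hgu, hgv, RingAut.one_apply]
    module

/-- If every basis of a plane is fixed by a semilinear, nonlinear element of `A`, then `A` contains
nontrivial transvections. -/
theorem exists_transvectionScalars_ne_zero [Finite A] [FaithfulSMul A W] [Finite T]
    (s : A →* RingAut T) (hs : ∀ (g : A) (c : T) (w : W), g • c • w = s g c • g • w)
    (h2 : Module.finrank T W = 2)
    (hbad : ∀ u v : W, LinearIndependent T ![u, v] → ∃ g : A, g • u = u ∧ g • v = v ∧ s g ≠ 1)
    {u v : W} (huv : LinearIndependent T ![u, v]) :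
    ∃ c ∈ transvectionScalars s u v hs, c ≠ 0 := by
  classical
  by_contra! hC
  have hu0 : u ≠ 0 := huv.ne_zero 0
  let D : Subgroup A :=
    { carrier := {g | g • u = u ∧ ∃ c : T, g • v = v + c • u}
      one_mem' := ⟨one_smul _ _, 0, by simp⟩
      mul_mem' := by
        rintro g h ⟨hgu, c, hgv⟩ ⟨hhu, d, hhv⟩
        refine ⟨by rw [mul_smul, hhu, hgu], c + s g d, ?_⟩
        rw [mul_smul, hhv, smul_add, hs, hgu, hgv]
        module
      inv_mem' := by
        rintro g ⟨hgu, c, hgv⟩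
        refine ⟨by rw [inv_smul_eq_iff, hgu], s g⁻¹ (-c), ?_⟩
        rw [inv_smul_eq_iff, smul_add, hs, hgu, hgv, ← RingAut.mul_apply,
          ← map_mul, mul_inv_cancel, map_one, RingAut.one_apply]
        module }
  have : Fintype D := Fintype.ofFinite D
  have hinj : ∀ g h : D, s g = s h → g = h := by
    intro g h hgh
    obtain ⟨hu, c, hv⟩ := (g⁻¹ * h : D).2
    have hs1 : s (g⁻¹ * h : D) = 1 := by simp [hgh]
    have hc : c = 0 := hC c ⟨_, hs1, hu, hv⟩
    rw [hc, zero_smul, add_zero] at hv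
    have := eq_one_of_smul_pair s hs h2 huv hs1 hu hv
    exact inv_mul_eq_one.1 (Subtype.ext this)
  -- Without transvections `s` is injective on `D`, so Dedekind's independence of characters gives
  -- an element of nonzero trace. Averaging `θ • v` over `D` then yields a `D`-fixed vector `v₀` in
  -- `v + T u`.
  obtain ⟨θ, hθ⟩ : ∃ θ : T, ∑ g : D, s g θ ≠ 0 := by
    by_contra! h0
    let F : D → T →* T := fun g => ((s g : T →+* T) : T →* T)
    have hF : Function.Injective F := fun g h hgh =>
      hinj g h (RingEquiv.ext fun x => DFunLike.congr_fun hgh x)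
    have hli := (linearIndependent_monoidHom T T).comp F hF
    rw [Fintype.linearIndependent_iff] at hli
    refine one_ne_zero (hli (fun _ => 1) ?_ 1)
    funext x
    simpa [F] using h0 x
  set τ := ∑ g : D, s g θ with hτ
  choose c hc using fun g : D => g.2.2
  let w₀ : W := ∑ g : D, (g : A) • θ • v
  have hw₀ : ∀ h : D, (h : A) • w₀ = w₀ := by
    intro h
    simp only [w₀, Finset.smul_sum, smul_smul (h : A)]
    exact Fintype.sum_equiv (Equiv.mulLeft h) _ _ fun x => rfl
  have hτD : ∀ h : D, s h τ = τ := by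
    intro h
    rw [hτ, map_sum]
    refine Fintype.sum_equiv (Equiv.mulLeft h) _ _ fun x => ?_
    simp
  obtain ⟨κ, hκ⟩ : ∃ κ : T, w₀ = τ • v + κ • u := by
    refine ⟨∑ g : D, s g θ * c g, ?_⟩
    simp only [w₀, hτ, Finset.sum_smul, ← Finset.sum_add_distrib]
    refine Finset.sum_congr rfl fun g _ => ?_
    rw [hs, hc, smul_add, smul_smul]
  let v₀ : W := τ⁻¹ • w₀
  have hv₀ : v₀ = v + (τ⁻¹ * κ) • u := by
    simp only [v₀, hκ, smul_add, smul_smul, inv_mul_cancel₀ hθ, one_smul]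
  have hv₀D : ∀ h : D, (h : A) • v₀ = v₀ := by
    intro h
    simp only [v₀]
    rw [hs, hw₀, map_inv₀, hτD]
  clear_value v₀
  obtain ⟨μ, hμ0, hμ⟩ := exists_generator_units T
  -- A nonlinear `g` fixing this basis lies in `D`, hence fixes `v₀`, hence `s g μ = μ`: a
  -- contradiction.
  have hli : LinearIndependent T ![u, v₀ + μ • u] := by
    rw [LinearIndependent.pair_iff] at huv ⊢
    intro a b hab
    obtain ⟨h1, h2⟩ := huv (a + b * (τ⁻¹ * κ + μ)) b (by
      rw [← hab, hv₀]
      module)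
    subst h2
    exact ⟨by simpa using h1, rfl⟩
  obtain ⟨g, hgu, hgv, hg⟩ := hbad _ _ hli
  have hgv₀ : g • v₀ = v₀ + (μ - s g μ) • u := by
    rw [smul_add, hs, hgu] at hgv
    rw [eq_sub_of_add_eq hgv]
    module
  have hgD : g ∈ D := by
    refine ⟨hgu, μ - s g μ + τ⁻¹ * κ - s g (τ⁻¹ * κ), ?_⟩
    have hv : v = v₀ - (τ⁻¹ * κ) • u := by rw [hv₀]; module
    conv_lhs => rw [hv, smul_sub, hs, hgu, hgv₀, hv₀]
    module
  have h3 : (μ - s g μ) • u = 0 := by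
    have := hv₀D ⟨g, hgD⟩
    rw [hgv₀] at this
    simpa using this
  have h4 := (smul_eq_zero.1 h3).resolve_right hu0
  exact hg (ringAut_eq_one_of_fix_generator hμ _ (sub_eq_zero.1 h4).symm)

/-- Conjugating the transvection with scalar `c` by a nonlinear `g` fixing `u` and `(μ / c) • v`
gives the scalar `c * (s g μ / μ)`. The rescaling by `μ / c` is chosen so that this ratio involves
only the generator, which rules out a prime-field ratio. -/
theorem exists_linearIndependent_transvectionScalars [Finite A] [FaithfulSMul A W] [Finite T]
    {p : ℕ} [Fact p.Prime] [Algebra (ZMod p) T]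
    (s : A →* RingAut T) (hs : ∀ (g : A) (c : T) (w : W), g • c • w = s g c • g • w)
    (h2 : Module.finrank T W = 2)
    (hbad : ∀ u v : W, LinearIndependent T ![u, v] → ∃ g : A, g • u = u ∧ g • v = v ∧ s g ≠ 1)
    {u v : W} (huv : LinearIndependent T ![u, v]) :
    ∃ c₀ ∈ transvectionScalars s u v hs, ∃ c₁ ∈ transvectionScalars s u v hs,
      LinearIndependent (ZMod p) ![c₀, c₁] := by
  obtain ⟨c, hcmem, hc⟩ := exists_transvectionScalars_ne_zero s hs h2 hbad huv
  obtain ⟨μ, hμ0, hμ⟩ := exists_generator_units T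
  have hl : μ / c ≠ 0 := div_ne_zero hμ0 hc
  have hli : LinearIndependent T ![u, (μ / c) • v] := by
    rw [LinearIndependent.pair_iff] at huv ⊢
    intro a b hab
    obtain ⟨h1, h2⟩ := huv a (b * (μ / c)) (by rw [← hab, smul_smul])
    exact ⟨h1, (mul_eq_zero.1 h2).resolve_right hl⟩
  obtain ⟨g, hgu, hgv, hg⟩ := hbad _ _ hli
  refine ⟨c, hcmem, c * (s g μ / μ), ?_, ?_⟩
  · obtain ⟨t, ht, htu, htv⟩ := hcmem
    have hgl : s g (μ / c) ≠ 0 := by simpa using hl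
    have hgiu : g⁻¹ • u = u := by rw [inv_smul_eq_iff, hgu]
    rw [hs] at hgv
    have hgv' : g • v = ((μ / c) / s g (μ / c)) • v := by
      rw [div_eq_inv_mul, mul_smul, ← hgv, smul_smul, inv_mul_cancel₀ hgl, one_smul]
    set ν := (μ / c) / s g (μ / c) with hν
    have hν0 : ν ≠ 0 := div_ne_zero hl hgl
    have hginv : g⁻¹ • v = (s g⁻¹ ν⁻¹) • v := by
      rw [inv_smul_eq_iff, hs, hgv', smul_smul, ← RingAut.mul_apply, ← map_mul, mul_inv_cancel,
        map_one, RingAut.one_apply, inv_mul_cancel₀ hν0, one_smul]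
    refine ⟨g * t * g⁻¹, by simp [ht], by rw [mul_smul, mul_smul, hgiu, htu, hgu], ?_⟩
    rw [mul_smul, mul_smul, hginv, hs t, ht, RingAut.one_apply, htv, smul_add, smul_add, ← hginv,
      smul_inv_smul, smul_smul, hs, hgu, map_mul, ← RingAut.mul_apply, ← map_mul, mul_inv_cancel,
      map_one, RingAut.one_apply]
    congr 2
    have : s g c ≠ 0 := by simpa using hc
    have : s g μ ≠ 0 := by simpa using hμ0
    rw [hν, map_div₀]
    field_simp
  · rw [LinearIndependent.pair_iff' hc]
    intro k hk
    refine hg (ringAut_eq_one_of_map_generator hμ (s g) (k := k) ?_)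
    rw [Algebra.smul_def] at hk ⊢
    field_simp at hk
    exact hk.symm

/-- A `p`-solvable group of semilinear transformations of a plane in characteristic `p` has a basis
of the plane all of whose fixing elements are linear. -/
theorem IsPSolvable.exists_pair_of_semilinear [Finite A] [FaithfulSMul A W] [Finite T] {p : ℕ}
    [hprime : Fact p.Prime] [CharP T p] (hA : IsPSolvable p A) (s : A →* RingAut T)
    (hs : ∀ (g : A) (c : T) (w : W), g • c • w = s g c • g • w) (h2 : Module.finrank T W = 2) :
    ∃ u v : W, LinearIndependent T ![u, v] ∧
      ∀ g : A, g • u = u → g • v = v → s g = 1 := by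
  by_contra! hbad
  let _ : Algebra (ZMod p) T := ZMod.algebra T p
  let ρ₀ : s.ker →* Module.End T W :=
    { toFun := fun g =>
        { toFun := fun w => (g : A) • w
          map_add' := smul_add _
          map_smul' := fun c w => by
            rw [hs, (MonoidHom.mem_ker).1 g.2]
            rfl }
      map_one' := by ext; simp
      map_mul' := fun g h => by ext; simp [mul_smul] }
  refine not_isPSolvable_of_transvections (p := p) h2 ρ₀.toHomUnits (fun u v huv => ?_)
    (hA.of_injective hprime.out s.ker.subtype Subtype.val_injective)
  obtain ⟨c₀, h₀, c₁, h₁, hli⟩ :=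
    exists_linearIndependent_transvectionScalars (p := p) s hs h2 hbad huv
  refine ⟨c₀, c₁, hli, fun i j => ?_⟩
  obtain ⟨g, hg, hgu, hgv⟩ := add_mem (ZMod.smul_mem h₀ i) (ZMod.smul_mem h₁ j)
  exact ⟨⟨g, hg⟩, hgu, hgv⟩

end SemilinearPlane

/-! ### From a base of the linear part to a base of the whole group -/

section Base

open scoped Pointwise

variable {T V : Type*} [Field T] [AddCommGroup V] [Module T V]

theorem linearGroup_fixes_span {g : Equiv.Perm V} (hg : g ∈ linearGroup T V) {S : Set V}
    (hS : ∀ x ∈ S, g x = x) {x : V} (hx : x ∈ Submodule.span T S) : g x = x := by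
  induction hx using Submodule.span_induction with
  | mem x h => exact hS x h
  | zero => simpa using hg.2 0 0
  | add x y _ _ hx hy => rw [hg.1, hx, hy]
  | smul a x _ hx => rw [hg.2, hx]

theorem mem_linearGroup_of_fixes_generator {μ : T} (hμ : ∀ x : T, x ≠ 0 → ∃ n : ℕ, μ ^ n = x)
    {g : Equiv.Perm V} (hg : g ∈ semilinearGroup T V) {v : V} (hv : v ≠ 0) (hgv : g v = v)
    (hgμ : g (μ • v) = μ • v) : g ∈ linearGroup T V := by
  obtain ⟨hadd, σ, hσ⟩ := hg
  rw [hσ, hgv] at hgμ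
  have h1 : σ = 1 := ringAut_eq_one_of_fix_generator hμ σ (smul_left_injective T hv hgμ)
  exact ⟨hadd, fun c w => by rw [hσ, h1]; rfl⟩

theorem exists_pair_fixing_trivial [Finite T] [FiniteDimensional T V] {p : ℕ} [Fact p.Prime]
    [CharP T p] {G : Subgroup (Equiv.Perm V)} (hG : G ≤ semilinearGroup T V)
    (hp : IsPSolvable p G) (W : Submodule T V) (h2 : Module.finrank T W = 2) (F : Set V)
    (htriv : ∀ g ∈ G, g ∈ linearGroup T V → (∀ w ∈ W, g w = w) → (∀ x ∈ F, g x = x) → g = 1) :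
    ∃ u v : V, ∀ g ∈ G, g u = u → g v = v → (∀ x ∈ F, g x = x) → g = 1 := by
  have : Finite V := Module.finite_of_finite T
  have : Nontrivial W := Module.nontrivial_of_finrank_pos (R := T) (by omega)
  obtain ⟨w₀, hw₀⟩ := exists_ne (0 : W)
  let A : Subgroup (Equiv.Perm V) :=
    (G ⊓ MulAction.stabilizer (Equiv.Perm V) (W : Set V)) ⊓ fixingSubgroup (Equiv.Perm V) F
  have hAG : A ≤ G := fun g hg => hg.1.1
  have hAW : ∀ (g : A) (w : W), (g : Equiv.Perm V) w ∈ W := fun g w =>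
    (MulAction.mem_stabilizer_set.1 g.2.1.2 (w : V)).2 w.2
  choose σ hσ using fun g : A => (hG (hAG g.2)).2
  have hadd : ∀ (g : A) (v w : V), (g : Equiv.Perm V) (v + w) =
      (g : Equiv.Perm V) v + (g : Equiv.Perm V) w := fun g => (hG (hAG g.2)).1
  let _ : DistribMulAction A W :=
    { smul := fun g w => ⟨(g : Equiv.Perm V) w, hAW g w⟩
      one_smul := fun _ => rfl
      mul_smul := fun _ _ _ => rfl
      smul_zero := fun g => Subtype.ext (show (g : Equiv.Perm V) 0 = 0 by simpa using hσ g 0 0)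
      smul_add := fun g v w => Subtype.ext (hadd g v w) }
  have hsm : ∀ (g : A) (w : W), ((g • w : W) : V) = (g : Equiv.Perm V) w := fun _ _ => rfl
  -- The action on multiples of one nonzero vector determines the field automorphism, so `σ` is a
  -- homomorphism.
  have huniq : ∀ (g : A) (τ : RingAut T),
      (∀ c : T, (g : Equiv.Perm V) (c • (w₀ : V)) = τ c • (g : Equiv.Perm V) w₀) → σ g = τ := by
    intro g τ h
    ext c
    have hne : (g : Equiv.Perm V) (w₀ : V) ≠ 0 := by
      rw [← hsm, Submodule.coe_eq_zero.ne, smul_ne_zero_iff_ne]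
      exact hw₀
    exact smul_left_injective T hne ((hσ g c w₀).symm.trans (h c))
  let s : A →* RingAut T :=
    { toFun := σ
      map_one' := huniq 1 1 fun c => rfl
      map_mul' := fun g h => huniq _ _ fun c => by
        change (g : Equiv.Perm V) ((h : Equiv.Perm V) _) = _
        rw [hσ, hσ]
        rfl }
  have hlin : ∀ g : A, s g = 1 → (g : Equiv.Perm V) ∈ linearGroup T V := fun g h =>
    ⟨hadd g, fun c v => by rw [hσ, show σ g = 1 from h]; rfl⟩
  have hF : ∀ g : A, ∀ x ∈ F, (g : Equiv.Perm V) x = x := fun g x hx =>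
    (mem_fixingSubgroup_iff _).1 g.2.2 x hx
  have : FaithfulSMul A W := by
    rw [faithfulSMul_iff]
    intro g hg
    have hg' : ∀ w ∈ W, (g : Equiv.Perm V) w = w := fun w hw =>
      congrArg Subtype.val (hg ⟨w, hw⟩)
    refine Subtype.ext (htriv g (hAG g.2) (hlin g (huniq g 1 fun c => ?_)) hg' (hF g))
    rw [hg' _ (W.smul_mem c w₀.2), hg' _ w₀.2, RingAut.one_apply]
  have hpA : IsPSolvable p A :=
    hp.of_injective Fact.out (Subgroup.inclusion hAG) (Subgroup.inclusion_injective hAG)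
  obtain ⟨u, v, huv, h⟩ := hpA.exists_pair_of_semilinear (W := W) s
    (fun g c w => Subtype.ext (hσ g c w)) h2
  refine ⟨u, v, fun g hg hgu hgv hgF => ?_⟩
  -- Fixing a basis of `W` already preserves `W`, so the stabilizer of `u`, `v` and `F` in `G` lies
  -- in `A`.
  have hmaps : ∀ f ∈ G, f u = u → f v = v → ∀ w ∈ W, f w ∈ W := by
    intro f hf hfu hfv w hw
    obtain ⟨hfadd, τ, hτ⟩ := hG hf
    obtain ⟨a, b, hab⟩ := exists_eq_smul_add_smul h2 huv ⟨w, hw⟩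
    have hw' : w = a • (u : V) + b • (v : V) := congrArg Subtype.val hab
    rw [hw', hfadd, hτ, hτ, hfu, hfv]
    exact W.add_mem (W.smul_mem _ u.2) (W.smul_mem _ v.2)
  have hgA : g ∈ A := by
    refine ⟨⟨hg, MulAction.mem_stabilizer_set.2 fun w => ⟨fun hw => ?_, hmaps g hg hgu hgv w⟩⟩,
      (mem_fixingSubgroup_iff _).2 hgF⟩
    have := hmaps g⁻¹ (inv_mem hg) (by rw [Equiv.Perm.inv_eq_iff_eq, hgu])
      (by rw [Equiv.Perm.inv_eq_iff_eq, hgv]) _ hw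
    simpa using this
  have hs1 := h ⟨g, hgA⟩ (Subtype.ext hgu) (Subtype.ext hgv)
  exact congrArg Subtype.val (eq_one_of_smul_pair s (fun g c w => Subtype.ext (hσ g c w)) h2 huv
    hs1 (Subtype.ext hgu) (Subtype.ext hgv))

theorem minBaseSize_le_iff {X : Type*} [Finite X] (G : Subgroup (Equiv.Perm X)) (n : ℕ) :
    minBaseSize G X ≤ n ↔
      ∃ B : Finset X, B.card ≤ n ∧ ∀ g ∈ G, (∀ x ∈ B, g x = x) → g = 1 := by
  have hfix : ∀ B : Finset X, fixingSubgroup G (B : Set X) = ⊥ ↔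
      ∀ g ∈ G, (∀ x ∈ B, g x = x) → g = 1 := by
    intro B
    rw [Subgroup.eq_bot_iff_forall]
    constructor
    · intro h g hg hB
      exact congrArg Subtype.val (h ⟨g, hg⟩ ((mem_fixingSubgroup_iff _).2 hB))
    · intro h g hg
      exact Subtype.ext (h g g.2 ((mem_fixingSubgroup_iff _).1 hg))
  constructor
  · intro h
    have := Fintype.ofFinite X
    -- Needed because `sInf ∅ = 0`; the whole set `X` is a base.
    have hne : {n : ℕ | ∃ s : Finset X, s.card = n ∧
        fixingSubgroup G (s : Set X) = ⊥}.Nonempty :=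
      ⟨_, Finset.univ, rfl, (hfix _).2 fun g _ hg => Equiv.ext fun x => hg x (Finset.mem_univ x)⟩
    obtain ⟨B, hB, hB'⟩ := Nat.sInf_mem hne
    exact ⟨B, hB.trans_le h, (hfix B).1 hB'⟩
  · rintro ⟨B, hB, h⟩
    have hmem : B.card ∈ {n : ℕ | ∃ s : Finset X, s.card = n ∧
        fixingSubgroup G (s : Set X) = ⊥} := ⟨B, rfl, (hfix B).2 h⟩
    exact (Nat.sInf_le hmem).trans hB

/-- A spanning set of a subspace of small dimension, enlarged if necessary so that it contains a
nonzero vector. -/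
theorem exists_finset_span_ge_of_finrank_le [FiniteDimensional T V] [Nontrivial V]
    (W : Submodule T V) {n : ℕ} (hn : 1 ≤ n) (hW : Module.finrank T W ≤ n) :
    ∃ B : Finset V, B.card ≤ n ∧ W ≤ Submodule.span T B ∧ ∃ v ∈ B, v ≠ 0 := by
  classical
  rcases eq_or_ne W ⊥ with rfl | hne
  · obtain ⟨v, hv⟩ := exists_ne (0 : V)
    exact ⟨{v}, by simpa using hn, bot_le, v, by simp, hv⟩
  · let b := Module.finBasis T W
    have hspan : W ≤ Submodule.span T
        (Finset.univ.image fun i => (b i : V) : Finset V) := by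
      have h := congrArg (Submodule.map W.subtype) b.span_eq
      rw [Submodule.map_span, Submodule.map_top, Submodule.range_subtype, ← Set.range_comp] at h
      rw [Finset.coe_image, Finset.coe_univ, Set.image_univ]
      exact h.ge
    have : Nontrivial W := Submodule.nontrivial_iff_ne_bot.2 hne
    let i₀ : Fin (Module.finrank T W) := ⟨0, Module.finrank_pos⟩
    refine ⟨_, Finset.card_image_le.trans (by simpa using hW), hspan, (b i₀ : V), ?_, ?_⟩
    · exact Finset.mem_image_of_mem _ (Finset.mem_univ _)
    · simpa using b.ne_zero i₀

theorem exists_base_of_linear_base [Finite T] [FiniteDimensional T V] {p : ℕ} [Fact p.Prime]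
    [CharP T p] {G : Subgroup (Equiv.Perm V)} (hG : G ≤ semilinearGroup T V)
    (hp : IsPSolvable p G) {k : ℕ} {S : Finset V} (hS : S.card ≤ k + 2)
    (hbase : ∀ g ∈ G ⊓ linearGroup T V, (∀ x ∈ S, g x = x) → g = 1) :
    ∃ B : Finset V, B.card ≤ k + 2 ∧ ∀ g ∈ G, (∀ x ∈ B, g x = x) → g = 1 := by
  classical
  rcases subsingleton_or_nontrivial V with hV | hV
  · exact ⟨∅, by simp, fun g _ _ => Subsingleton.elim _ _⟩
  have hspan : ∀ g ∈ G, g ∈ linearGroup T V → ∀ B : Set V, (∀ x ∈ B, g x = x) →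
      Submodule.span T (S : Set V) ≤ Submodule.span T B → g = 1 := by
    intro g hg hgl B hB hSB
    exact hbase g ⟨hg, hgl⟩ fun x hx =>
      linearGroup_fixes_span hgl hB (hSB (Submodule.subset_span hx))
  have hle : Module.finrank T (Submodule.span T (S : Set V)) ≤ k + 2 :=
    (finrank_span_finset_le_card S).trans hS
  set W := Submodule.span T (S : Set V) with hWdef
  rcases Nat.lt_or_ge (Module.finrank T W) (k + 2) with hlt | hge
  · obtain ⟨μ, -, hμ⟩ := exists_generator_units T
    obtain ⟨B, hB, hWB, v, hvB, hv⟩ :=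
      exists_finset_span_ge_of_finrank_le W (n := k + 1) (by omega) (by omega)
    -- The spare point `μ • v` forces linearity; then `B` suffices.
    refine ⟨insert (μ • v) B, (Finset.card_insert_le _ _).trans (by omega), fun g hg hgB => ?_⟩
    have hgB' : ∀ x ∈ B, g x = x := fun x hx => hgB x (Finset.mem_insert_of_mem hx)
    exact hspan g hg (mem_linearGroup_of_fixes_generator hμ (hG hg) hv (hgB' v hvB)
      (hgB _ (Finset.mem_insert_self _ _))) B hgB' hWB
  · let b : Module.Basis (Fin k ⊕ Fin 2) T W :=
      (Module.finBasisOfFinrankEq T W (le_antisymm hle hge)).reindex finSumFinEquiv.symm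
    have hbV : LinearIndependent T fun i => (b i : V) :=
      b.linearIndependent.map' W.subtype W.ker_subtype
    have hbspan : Submodule.span T (Set.range fun i => (b i : V)) = W := by
      have h := congrArg (Submodule.map W.subtype) b.span_eq
      rwa [Submodule.map_span, Submodule.map_top, Submodule.range_subtype, ← Set.range_comp] at h
    let P : Submodule T V := Submodule.span T (Set.range fun i : Fin 2 => (b (Sum.inr i) : V))
    have hP : Module.finrank T P = 2 := by
      exact finrank_span_eq_card (hbV.comp _ Sum.inr_injective)
    let F : Finset V := Finset.univ.image fun i : Fin k => (b (Sum.inl i) : V)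
    obtain ⟨u, v, huv⟩ := exists_pair_fixing_trivial hG hp P hP (F : Set V) (by
      intro g hg hgl hgP hgF
      refine hspan g hg hgl (Set.range fun i => (b i : V)) ?_ hbspan.ge
      rintro _ ⟨i | i, rfl⟩
      · exact hgF _ (Finset.mem_image_of_mem _ (Finset.mem_univ i))
      · exact hgP _ (Submodule.subset_span ⟨i, rfl⟩))
    refine ⟨insert u (insert v F), ?_, fun g hg hgB => ?_⟩
    · have h1 := Finset.card_insert_le u (insert v F)
      have h2 := Finset.card_insert_le v F
      have h3 : F.card ≤ k := Finset.card_image_le.trans (by simp)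
      omega
    · exact huv g hg (hgB u (by simp)) (hgB v (by simp)) fun x hx =>
        hgB x (Finset.mem_insert_of_mem (Finset.mem_insert_of_mem hx))

end Base

theorem theorem5p1 {K T V : Type*} [Field K] [Finite K] [Field T] [Finite T] [Algebra K T]
    [AddCommGroup V] [Module T V] [FiniteDimensional T V]
    (p : ℕ) [CharP K p] (hT : 1 < Module.finrank K T)
    (G H : Subgroup (Equiv.Perm V)) (hG : G ≤ semilinearGroup T V) (hp : IsPSolvable p G)
    (hH : H = G ⊓ linearGroup T V)
    (hb : minBaseSize H V ≤ baseBound (Nat.card T)) :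
    minBaseSize G V ≤ baseBound (Nat.card T) := by
  have : Finite V := Module.finite_of_finite T
  have : Fact p.Prime := ⟨CharP.char_is_prime K p⟩
  have : CharP T p := charP_of_injective_algebraMap (algebraMap K T).injective p
  obtain ⟨k, hk⟩ : ∃ k, baseBound (Nat.card T) = k + 2 := by
    unfold baseBound
    split_ifs
    exacts [⟨1, rfl⟩, ⟨0, rfl⟩]
  rw [hk, minBaseSize_le_iff] at hb ⊢
  obtain ⟨S, hS, hbase⟩ := hb
  exact exists_base_of_linear_base hG hp hS (hH ▸ hbase)
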